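/- Let $(X,d)$ be a Polish metric space with its Borel $\sigma$-algebra, and let $m=(m_x)_{x\in X}$ be a random walk on $X$: a family of Borel probability measures on $X$ depending measurably on $x$, each with finite first moment. Let $\nu$ be a $\sigma$-finite measure on $X$ that is reversible for $m$, i.e. $dm_x(y)\,d\nu(x)=dm_y(x)\,d\nu(y)$. Put $L_m(A,B)=\int_A\int_B dm_x(y)\,d\nu(x)$ and $P_m(E)=L_m(E,X\setminus E)$, and assume that the space is $m$-connected: $L_m(A,B)>0$ for all $\nu$-measurable sets $A,B$ of positive measure with $A\cup B=X$. Let $\mathcal F_m:L^2(X,\nu)\to[0,+\infty]$ be $\mathcal F_m(u)=\frac12\int_X\int_X|u(y)-u(x)|\,dm_x(y)\,d\nu(x)$ (possibly $+\infty$), and define the multivalued operator $\Delta^m_1$ in $L^2(X,\nu)$ by: $v\in\Delta^m_1u$ if and only if $-v\in\partial\mathcal F_m(u)$, where $\partial$ is the subdifferential in $L^2(X,\nu)$. Let $\Omega\subset X$ be $\nu$-measurable with $0<\nu(\Omega)<\nu(X)$, and put $\lambda^m_\Omega=P_m(\Omega)/\nu(\Omega)$. Then the following are equivalent: (i) $\Omega$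 is $m$-calibrable, i.e. $\lambda^m_\Omega=\inf\{P_m(E)/\nu(E) : E\subset\Omega \text{ is } \nu\text{-measurable},\ \nu(E)>0\}$; (ii) there exists a $\nu$-measurable function $\tau:X\to\mathbb R$ equal to $1$ on $\Omega$ such that $-\lambda^m_\Omega\,\tau\in\Delta^m_1\chi_\Omega$; (iii) $-\lambda^m_\Omega\,\tau^*\in\Delta^m_1\chi_\Omega$, where $\tau^*(x)=1$ for $x\in\Omega$ and $\tau^*(x)=-\frac{1}{\lambda^m_\Omega}m_x(\Omega)$ for $x\in X\setminus\Omega$. -/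

import Mathlib

open MeasureTheory ProbabilityTheory
open scoped ENNReal

namespace MRW

noncomputable section

/-- `m` is a random walk on the metric space `X`: a measurable family of probability measures
(a Markov kernel), each with finite first moment. -/
structure IsRandomWalk {X : Type*} [MetricSpace X] [MeasurableSpace X] (m : Kernel X X) :
    Prop where
  isMarkov : IsMarkovKernel m
  moment : ∀ x : X, ∃ z : X, ∫⁻ y, ENNReal.ofReal (dist z y) ∂(m x) < ∞

/-- The `m`-interaction `L_m(A, B) = ∫_A ∫_B dm_x(y) dν(x)`. -/
def interaction {X : Type*} [MeasurableSpace X] (m : Kernel X X) (ν : Measure X)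
    (A B : Set X) : ℝ≥0∞ :=
  ∫⁻ x in A, m x B ∂ν

/-- The `m`-perimeter `P_m(E) = L_m(E, X \ E)`. -/
def perimeter {X : Type*} [MeasurableSpace X] (m : Kernel X X) (ν : Measure X)
    (E : Set X) : ℝ≥0∞ :=
  interaction m ν E Eᶜ

/-- `m`-connectedness: `L_m(A, B) > 0` for all non-`ν`-null `ν`-measurable sets `A`, `B`
with `A ∪ B = X`. -/
def IsConnected {X : Type*} [MeasurableSpace X] (m : Kernel X X) (ν : Measure X) : Prop :=
  ∀ A B : Set X, NullMeasurableSet A ν → NullMeasurableSet B ν → ν A ≠ 0 → ν B ≠ 0 →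
    A ∪ B = Set.univ → 0 < interaction m ν A B

/-- `TV_m(u) = 1/2 ∫ ∫ |u(y) - u(x)| dm_x(y) dν(x)`, as an element of `[0, ∞]`;
a `ν`-measurable function `u` lies in `BV_m(X, ν)` exactly if this is finite. -/
def totalVariation {X : Type*} [MeasurableSpace X] (m : Kernel X X) (ν : Measure X)
    (u : X → ℝ) : ℝ≥0∞ :=
  (1 / 2) * ∫⁻ x, ∫⁻ y, ENNReal.ofReal |u y - u x| ∂(m x) ∂ν

/-- The functional `F_m : L²(X, ν) → (-∞, ∞]`, which equals `TV_m` on `L² ∩ BV_m` and `+∞` on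
`L² \ BV_m` (where `totalVariation` is infinite). -/
def energy {X : Type*} [MeasurableSpace X] (m : Kernel X X) (ν : Measure X)
    (u : Lp ℝ 2 ν) : EReal :=
  ((totalVariation m ν u : ℝ≥0∞) : EReal)

/-- The subdifferential of a proper functional `Φ : H → (-∞, ∞]` on a real inner product space:
`v ∈ ∂Φ(u)` iff `Φ(u) + ⟨v, w - u⟩ ≤ Φ(w)` for all `w`. -/
def subdifferential {H : Type*} [NormedAddCommGroup H] [InnerProductSpace ℝ H]
    (Φ : H → EReal) (u : H) : Set H :=
  {v | ∀ w : H, Φ u + ((inner ℝ v (w - u) : ℝ) : EReal) ≤ Φ w}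

/-- The multivalued operator `Δ^m_1` in `L²(X, ν)`: `v ∈ Δ^m_1 u` iff `-v ∈ ∂F_m(u)`. -/
def oneLaplacian {X : Type*} [MeasurableSpace X] (m : Kernel X X) (ν : Measure X)
    (u : Lp ℝ 2 ν) : Set (Lp ℝ 2 ν) :=
  {v | -v ∈ subdifferential (energy m ν) u}

/-- The relation `v ∈ Δ^m_1 u` for functions: both are in `L²(X, ν)` and their classes satisfy the
relation there. -/
def MemOneLaplacian {X : Type*} [MeasurableSpace X] (m : Kernel X X) (ν : Measure X)
    (v u : X → ℝ) : Prop :=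
  ∃ (hv : MemLp v 2 ν) (hu : MemLp u 2 ν), hv.toLp v ∈ oneLaplacian m ν (hu.toLp u)

/-- The `m`-Cheeger constant of `Ω`, the infimum (taken in `[0, ∞]`) of `P_m(E) / ν(E)` over
`ν`-measurable `E ⊆ Ω` with `ν(E) > 0`. -/
def cheegerConstant {X : Type*} [MeasurableSpace X] (m : Kernel X X) (ν : Measure X)
    (Ω : Set X) : ℝ≥0∞ :=
  sInf {r | ∃ E : Set X, E ⊆ Ω ∧ NullMeasurableSet E ν ∧ 0 < ν E ∧ r = perimeter m ν E / ν E}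

/-- `Ω` is `m`-calibrable if it attains its own `m`-Cheeger constant. -/
def IsCalibrable {X : Type*} [MeasurableSpace X] (m : Kernel X X) (ν : Measure X)
    (Ω : Set X) : Prop :=
  cheegerConstant m ν Ω = perimeter m ν Ω / ν Ω

/-- The real number `λ^m_Ω = P_m(Ω) / ν(Ω)`
(`P_m(Ω) ≤ ν(Ω) < ∞` for the sets under consideration). -/
def lam {X : Type*} [MeasurableSpace X] (m : Kernel X X) (ν : Measure X) (Ω : Set X) : ℝ :=
  (perimeter m ν Ω / ν Ω).toReal

open Classical in
/-- `τ* = 1` on `Ω` and `τ*(x) = -(1 / λ^m_Ω) m_x(Ω)` off `Ω`. -/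
def tauStar {X : Type*} [MeasurableSpace X] (m : Kernel X X) (ν : Measure X) (Ω : Set X)
    (x : X) : ℝ :=
  if x ∈ Ω then 1 else -(1 / lam m ν Ω) * (m x Ω).toReal

end

end MRW

namespace MRW

/-! Put `g = λτ` with `τ = 1` on `Ω`. Then `⟨g, χ_Ω⟩ = λ ν(Ω) = P(Ω) = F(χ_Ω)`, so the subgradient
condition at `χ_Ω` reduces to `⟨g, w⟩ ≤ F(w)` for all `w` (`memOneLaplacian_neg_indicator_iff`).
Testing with `w = χ_E`, `E ⊆ Ω`, gives `λ ν(E) ≤ P(E)`, which is calibrability.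

Conversely, calibrability must give `⟨g, w⟩ ≤ F(w)` for `g = λ` on `Ω`, `g = -m_x(Ω)` off `Ω`
(`lintegral_pairing_le`). The inequality `λ ν(E) ≤ P(E)` is integrated over the superlevel sets in
`Ω` of the positive part of `w`. For the negative part it is used on the complements in `Ω` of the
superlevel sets, combined with `λ ν(Ω) = P(Ω)`. Pairs in `Ω × Ωᶜ` are compared pointwise; symmetry
of the joint measure turns the weight `m_x(Ω)` off `Ω` into an integral over such pairs. -/

/-- The two-variable layer cake formula. -/
theorem lintegral_ofReal_sub_eq {α : Type*} [MeasurableSpace α] (μ : Measure α) [SFinite μ]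
    {f g : α → ℝ} (hf : Measurable f) (hg : Measurable g) (hg0 : ∀ a, 0 ≤ g a) :
    ∫⁻ a, ENNReal.ofReal (f a - g a) ∂μ
      = ∫⁻ t in Set.Ioi (0 : ℝ), μ {a | g a ≤ t ∧ t < f a} := by
  have hS : MeasurableSet {p : ℝ × α | g p.2 ≤ p.1 ∧ p.1 < f p.2} :=
    (measurableSet_le (hg.comp measurable_snd) measurable_fst).inter
      (measurableSet_lt measurable_fst (hf.comp measurable_snd))
  have h1 := Measure.prod_apply (μ := volume.restrict (Set.Ioi (0 : ℝ))) (ν := μ) hS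
  have h2 := Measure.prod_apply_symm (μ := volume.restrict (Set.Ioi (0 : ℝ))) (ν := μ) hS
  rw [h1] at h2
  refine Eq.trans ?_ h2.symm
  refine lintegral_congr fun a => ?_
  have : (fun x => (x, a)) ⁻¹' {p : ℝ × α | g p.2 ≤ p.1 ∧ p.1 < f p.2} = Set.Ico (g a) (f a) := rfl
  rw [this, Measure.restrict_apply measurableSet_Ico]
  rw [← Real.volume_Ico]
  apply le_antisymm
  -- Restricting to `t > 0` loses at most the endpoint `t = g a`, which has length zero.
  · rw [← Real.volume_Ioo.trans Real.volume_Ico.symm]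
    exact measure_mono fun t ht => ⟨⟨ht.1.le, ht.2⟩, (hg0 a).trans_lt ht.1⟩
  · exact measure_mono Set.inter_subset_left

/-! ### Reversibility, perimeter and total variation. -/

section Symmetric

variable {X : Type*} [MeasurableSpace X] (m : Kernel X X) [IsMarkovKernel m]
  (ν : Measure X)

variable {m ν} in
/-- Reversibility says that the joint measure `dm_x(y) dν(x)` is symmetric. -/
theorem map_swap_compProd [SigmaFinite ν] (hrev : m.IsReversible ν) :
    (ν ⊗ₘ m).map Prod.swap = ν ⊗ₘ m := by
  symm
  refine Measure.ext_of_generateFrom_of_iUnion _ (fun i => spanningSets ν i ×ˢ Set.univ)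
    generateFrom_prod.symm isPiSystem_prod ?_ ?_ ?_ ?_
  · rw [← Set.iUnion_prod_const, iUnion_spanningSets, Set.univ_prod_univ]
  · exact fun i => ⟨_, measurableSet_spanningSets ν i, _, MeasurableSet.univ, rfl⟩
  · intro i
    rw [Measure.compProd_apply_prod (measurableSet_spanningSets ν i) MeasurableSet.univ]
    simpa using (measure_spanningSets_lt_top ν i).ne
  · rintro _ ⟨s, hs, t, ht, rfl⟩
    rw [Measure.map_apply measurable_swap (hs.prod ht), Set.preimage_swap_prod,
      Measure.compProd_apply_prod hs ht, Measure.compProd_apply_prod ht hs]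
    exact hrev hs ht

variable {m ν} in
theorem lintegral_swap_compProd [SigmaFinite ν] (hrev : m.IsReversible ν) {f : X × X → ℝ≥0∞}
    (hf : Measurable f) :
    ∫⁻ p, f p.swap ∂(ν ⊗ₘ m) = ∫⁻ p, f p ∂(ν ⊗ₘ m) := by
  conv_rhs => rw [← map_swap_compProd hrev]
  rw [lintegral_map hf measurable_swap]

variable {m ν} in
/-- A `ν`-null set is `m_x`-null for `ν`-almost every `x`. -/
theorem ae_ae_of_ae (hrev : m.IsReversible ν) {p : X → Prop} (hp : ∀ᵐ x ∂ν, p x) :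
    ∀ᵐ x ∂ν, ∀ᵐ y ∂(m x), p y := by
  have h := hrev.invariant
  rw [← h.def] at hp
  exact Measure.ae_ae_of_ae_bind m.aemeasurable hp

variable {m ν} in
theorem ae_measure_congr (hrev : m.IsReversible ν) {s t : Set X} (h : s =ᵐ[ν] t) :
    ∀ᵐ x ∂ν, m x s = m x t := by
  filter_upwards [ae_ae_of_ae hrev h] with x hx using measure_congr hx

-- A single `m x` may charge `ν`-null sets; invariance of `ν` excludes this for almost every `x`.
variable {m ν} in
theorem perimeter_congr (hrev : m.IsReversible ν) {s t : Set X} (h : s =ᵐ[ν] t) :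
    perimeter m ν s = perimeter m ν t := by
  unfold perimeter interaction
  rw [Measure.restrict_congr_set h]
  exact lintegral_congr_ae (ae_restrict_of_ae (ae_measure_congr hrev h.compl))

theorem perimeter_eq_compProd [SigmaFinite ν] {s : Set X} (hs : MeasurableSet s) :
    perimeter m ν s = (ν ⊗ₘ m) (s ×ˢ sᶜ) :=
  (Measure.compProd_apply_prod hs hs.compl).symm

/-- Finite measure thus forces finite perimeter, so passing to real numbers loses nothing. -/
theorem perimeter_le (s : Set X) : perimeter m ν s ≤ ν s := by
  refine (lintegral_mono fun x => prob_le_one).trans ?_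
  simp

variable {m ν} in
theorem totalVariation_congr (hrev : m.IsReversible ν) {u v : X → ℝ} (h : u =ᵐ[ν] v) :
    totalVariation m ν u = totalVariation m ν v := by
  unfold totalVariation
  congr 1
  refine lintegral_congr_ae ?_
  filter_upwards [h, ae_ae_of_ae hrev h] with x hx hy
  refine lintegral_congr_ae ?_
  filter_upwards [hy] with y hy
  rw [hx, hy]

variable {m ν} in
/-- By symmetry, the total variation is the integral of the positive part of the difference. -/
theorem totalVariation_eq [SigmaFinite ν] (hrev : m.IsReversible ν) {u : X → ℝ}
    (hu : Measurable u) :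
    totalVariation m ν u = ∫⁻ p, ENNReal.ofReal (u p.1 - u p.2) ∂(ν ⊗ₘ m) := by
  have h1 : Measurable fun p : X × X => ENNReal.ofReal (u p.1 - u p.2) := by fun_prop
  have h2 : Measurable fun p : X × X => ENNReal.ofReal |u p.2 - u p.1| := by fun_prop
  have h3 := lintegral_swap_compProd hrev h1
  unfold totalVariation
  rw [← Measure.lintegral_compProd h2]
  have h4 : ∀ p : X × X, ENNReal.ofReal |u p.2 - u p.1|
      = ENNReal.ofReal (u p.1 - u p.2) + ENNReal.ofReal (u p.swap.1 - u p.swap.2) := by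
    intro p
    rcases le_total (u p.1) (u p.2) with h | h
    · rw [abs_of_nonneg (by linarith), ENNReal.ofReal_of_nonpos (p := u p.1 - u p.2) (by linarith)]
      simp
    · rw [abs_of_nonpos (by linarith), ENNReal.ofReal_of_nonpos (p := u p.swap.1 - u p.swap.2)
        (by simpa using h)]
      simp
  rw [lintegral_congr h4, lintegral_add_left h1, h3, ← two_mul, ← mul_assoc, one_div,
    ENNReal.inv_mul_cancel two_ne_zero ENNReal.ofNat_ne_top, one_mul]

variable {m ν} in
theorem totalVariation_indicator [SigmaFinite ν] (hrev : m.IsReversible ν) {s : Set X}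
    (hs : NullMeasurableSet s ν) :
    totalVariation m ν (s.indicator fun _ => 1) = perimeter m ν s := by
  obtain ⟨t, -, ht, hts⟩ := hs.exists_measurable_subset_ae_eq
  rw [← perimeter_congr hrev hts, perimeter_eq_compProd m ν ht,
    ← totalVariation_congr hrev (indicator_ae_eq_of_ae_eq_set hts),
    totalVariation_eq hrev (measurable_const.indicator ht),
    ← lintegral_indicator_one (ht.prod ht.compl)]
  refine lintegral_congr fun p => ?_
  by_cases h1 : p.1 ∈ t <;> by_cases h2 : p.2 ∈ t <;> simp [Set.indicator, h1, h2]

end Symmetric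

/-- An integral is bounded by `c ∈ [0, ∞]` if its positive part exceeds its negative part by at
most `c`. -/
theorem integral_le_of_lintegral_le {α : Type*} [MeasurableSpace α] {μ : Measure α} {f : α → ℝ}
    (hf : Integrable f μ) {c : ℝ≥0∞}
    (h : ∫⁻ a, ENNReal.ofReal (f a) ∂μ ≤ ∫⁻ a, ENNReal.ofReal (-f a) ∂μ + c) :
    ((∫ a, f a ∂μ : ℝ) : EReal) ≤ (c : EReal) := by
  rcases eq_or_ne c ∞ with rfl | hc
  · simp
  lift c to NNReal using hc
  rw [integral_eq_lintegral_pos_part_sub_lintegral_neg_part hf]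
  have hn : ∫⁻ a, ENNReal.ofReal (-f a) ∂μ ≠ ∞ := (hf.neg.lintegral_lt_top).ne
  have h' := ENNReal.toReal_mono (ENNReal.add_ne_top.2 ⟨hn, ENNReal.coe_ne_top⟩) h
  rw [ENNReal.toReal_add hn ENNReal.coe_ne_top] at h'
  have : (((c : ℝ≥0∞) : EReal)) = (((c : ℝ≥0∞).toReal : ℝ) : EReal) := rfl
  rw [this, EReal.coe_le_coe_iff]
  linarith

theorem measurable_measure_lt {α : Type*} [MeasurableSpace α] (μ : Measure α) (f : α → ℝ) :
    Measurable fun t : ℝ => μ {a | t < f a} := by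
  have : Antitone fun t : ℝ => μ {a | t < f a} :=
    fun s t hst => measure_mono fun x hx => lt_of_le_of_lt hst hx
  exact this.measurable

/-! ### Functional isoperimetric inequalities via level sets. -/

section Symmetric

variable {X : Type*} [MeasurableSpace X] {m : Kernel X X} {ν : Measure X}

/-- The isoperimetric inequality on the subsets of `Ω`, in functional form. -/
theorem mul_setLIntegral_le {Ω : Set X} (hΩ : MeasurableSet Ω) {l : ℝ≥0∞} (hl : l ≠ ∞)
    (h : ∀ E ⊆ Ω, MeasurableSet E → l * ν E ≤ (ν ⊗ₘ m) (E ×ˢ Eᶜ))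
    {f : X → ℝ} (hf : Measurable f) (hf0 : ∀ x, 0 ≤ f x) :
    l * ∫⁻ x in Ω, ENNReal.ofReal (f x) ∂ν
      ≤ ∫⁻ p in Ω ×ˢ Ω, ENNReal.ofReal (f p.1 - f p.2) ∂(ν ⊗ₘ m)
        + ∫⁻ p in Ω ×ˢ Ωᶜ, ENNReal.ofReal (f p.1) ∂(ν ⊗ₘ m) := by
  have hf1 : Measurable fun p : X × X => f p.1 := hf.comp measurable_fst
  have hf2 : Measurable fun p : X × X => f p.2 := hf.comp measurable_snd
  rw [lintegral_eq_lintegral_meas_lt _ (.of_forall hf0) hf.aemeasurable,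
    lintegral_ofReal_sub_eq _ hf1 hf2 fun p => hf0 p.2,
    lintegral_eq_lintegral_meas_lt _ (.of_forall fun p : X × X => hf0 p.1) hf1.aemeasurable,
    ← lintegral_const_mul' _ _ hl, ← lintegral_add_right _ (measurable_measure_lt _ _)]
  refine lintegral_mono fun t => ?_
  have hE : MeasurableSet {x | t < f x} := measurableSet_lt measurable_const hf
  have hE1 : MeasurableSet {p : X × X | t < f p.1} := measurableSet_lt measurable_const hf1
  have hE2 : MeasurableSet {p : X × X | f p.2 ≤ t ∧ t < f p.1} :=
    (measurableSet_le hf2 measurable_const).inter hE1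
  rw [Measure.restrict_apply hE, Measure.restrict_apply hE1, Measure.restrict_apply hE2]
  refine (h _ Set.inter_subset_right (hE.inter hΩ)).trans
    ((measure_mono ?_).trans (measure_union_le _ _))
  rintro ⟨x, y⟩
  simp only [Set.mem_prod, Set.mem_inter_iff, Set.mem_compl_iff, Set.mem_union, Set.mem_ofPred_eq]
  grind

/-- The isoperimetric inequality for the relative complements in `Ω`, in functional form. -/
theorem setLIntegral_le_mul {Ω : Set X} (hΩ : MeasurableSet Ω)
    (hfin : ν Ω ≠ ∞) {l : ℝ≥0∞} (hl : l ≠ ∞) (hlΩ : l * ν Ω = (ν ⊗ₘ m) (Ω ×ˢ Ωᶜ))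
    (h : ∀ E ⊆ Ω, MeasurableSet E → l * ν E ≤ (ν ⊗ₘ m) (E ×ˢ Eᶜ))
    {f : X → ℝ} (hf : Measurable f) (hf0 : ∀ x, 0 ≤ f x) :
    ∫⁻ p in Ω ×ˢ Ωᶜ, ENNReal.ofReal (f p.1) ∂(ν ⊗ₘ m)
      ≤ ∫⁻ p in Ω ×ˢ Ω, ENNReal.ofReal (f p.2 - f p.1) ∂(ν ⊗ₘ m)
        + l * ∫⁻ x in Ω, ENNReal.ofReal (f x) ∂ν := by
  have hf1 : Measurable fun p : X × X => f p.1 := hf.comp measurable_fst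
  have hf2 : Measurable fun p : X × X => f p.2 := hf.comp measurable_snd
  -- Subtract the inequality for `Ω \ N` from the equality `hlΩ` for `Ω`; the common term, the
  -- interaction of `Ω \ N` with `Ωᶜ`, is finite and cancels.
  have key : ∀ N ⊆ Ω, MeasurableSet N →
      (ν ⊗ₘ m) (N ×ˢ Ωᶜ) ≤ (ν ⊗ₘ m) ((Ω \ N) ×ˢ N) + l * ν N := by
    intro N hN hNm
    have hd : MeasurableSet (Ω \ N) := hΩ.diff hNm
    have e1 := h (Ω \ N) Set.sdiff_subset hd
    have hc : (Ω \ N)ᶜ = N ∪ Ωᶜ := by ext x; simp; grind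
    have e2 : (ν ⊗ₘ m) ((Ω \ N) ×ˢ (Ω \ N)ᶜ)
        ≤ (ν ⊗ₘ m) ((Ω \ N) ×ˢ N) + (ν ⊗ₘ m) ((Ω \ N) ×ˢ Ωᶜ) := by
      rw [hc, Set.prod_union]
      exact measure_union_le _ _
    have e3 : ν Ω = ν (Ω \ N) + ν N := (measure_sdiff_add_inter Ω hNm |>.symm).trans <| by
      rw [Set.inter_eq_right.2 hN]
    have e4 : (ν ⊗ₘ m) (Ω ×ˢ Ωᶜ) = (ν ⊗ₘ m) (N ×ˢ Ωᶜ) + (ν ⊗ₘ m) ((Ω \ N) ×ˢ Ωᶜ) := by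
      rw [← measure_union _ (hd.prod hΩ.compl), ← Set.union_prod, Set.union_sdiff_cancel hN]
      exact Set.disjoint_prod.2 (.inl Set.disjoint_sdiff_right)
    have e5 : (ν ⊗ₘ m) ((Ω \ N) ×ˢ Ωᶜ) ≠ ∞ := by
      refine ne_top_of_le_ne_top (ENNReal.mul_ne_top hl hfin) (hlΩ ▸ measure_mono ?_)
      exact Set.prod_mono Set.sdiff_subset le_rfl
    refine (ENNReal.add_le_add_iff_right e5).1 ?_
    rw [← e4, ← hlΩ, e3, mul_add]
    calc l * ν (Ω \ N) + l * ν N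
        ≤ (ν ⊗ₘ m) ((Ω \ N) ×ˢ N) + (ν ⊗ₘ m) ((Ω \ N) ×ˢ Ωᶜ) + l * ν N := by
          gcongr; exact e1.trans e2
      _ = _ := by ring
  rw [lintegral_eq_lintegral_meas_lt _ (.of_forall hf0) hf.aemeasurable,
    lintegral_ofReal_sub_eq _ hf2 hf1 fun p => hf0 p.1,
    lintegral_eq_lintegral_meas_lt _ (.of_forall fun p : X × X => hf0 p.1) hf1.aemeasurable,
    ← lintegral_const_mul' _ _ hl,
    ← lintegral_add_right _ ((measurable_measure_lt _ _).const_mul l)]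
  refine lintegral_mono fun t => ?_
  have hE : MeasurableSet {x | t < f x} := measurableSet_lt measurable_const hf
  have hE1 : MeasurableSet {p : X × X | t < f p.1} := measurableSet_lt measurable_const hf1
  have hE2 : MeasurableSet {p : X × X | f p.1 ≤ t ∧ t < f p.2} :=
    (measurableSet_le hf1 measurable_const).inter (measurableSet_lt measurable_const hf2)
  rw [Measure.restrict_apply hE, Measure.restrict_apply hE1, Measure.restrict_apply hE2]
  refine (measure_mono ?_).trans ((key _ Set.inter_subset_right (hE.inter hΩ)).trans
    (add_le_add_left (measure_mono ?_) _))
  · rintro ⟨x, y⟩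
    simp only [Set.mem_prod, Set.mem_inter_iff, Set.mem_compl_iff, Set.mem_ofPred_eq]
    grind
  · rintro ⟨x, y⟩
    simp only [Set.mem_prod, Set.mem_inter_iff, Set.mem_sdiff, Set.mem_ofPred_eq]
    grind

/-- The inequality `⟨g, w⟩ ≤ TV_m(w)` for `g = l` on `Ω` and `g = - m_x(Ω)` off `Ω`, with the
positive and the negative parts separated. -/
theorem lintegral_pairing_le [IsMarkovKernel m] [SigmaFinite ν] {Ω : Set X}
    (hrev : m.IsReversible ν) (hΩ : MeasurableSet Ω)
    (hfin : ν Ω ≠ ∞) {l : ℝ≥0∞} (hl : l ≠ ∞) (hlΩ : l * ν Ω = (ν ⊗ₘ m) (Ω ×ˢ Ωᶜ))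
    (h : ∀ E ⊆ Ω, MeasurableSet E → l * ν E ≤ (ν ⊗ₘ m) (E ×ˢ Eᶜ))
    {w : X → ℝ} (hw : Measurable w) :
    l * ∫⁻ x in Ω, ENNReal.ofReal (w x) ∂ν + ∫⁻ x in Ωᶜ, ENNReal.ofReal (-w x) * m x Ω ∂ν
      ≤ (l * ∫⁻ x in Ω, ENNReal.ofReal (-w x) ∂ν + ∫⁻ x in Ωᶜ, ENNReal.ofReal (w x) * m x Ω ∂ν)
        + totalVariation m ν w := by
  have swap : ∀ f : X → ℝ≥0∞, Measurable f → ∫⁻ x in Ωᶜ, f x * m x Ω ∂ν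
      = ∫⁻ p in Ω ×ˢ Ωᶜ, f p.2 ∂(ν ⊗ₘ m) := by
    intro f hf
    have e1 : ∫⁻ x in Ωᶜ, f x * m x Ω ∂ν = ∫⁻ p in Ωᶜ ×ˢ Ω, f p.1 ∂(ν ⊗ₘ m) := by
      rw [Measure.setLIntegral_compProd (f := fun p => f p.1) (hf.comp measurable_fst) hΩ.compl hΩ]
      simp
    rw [e1, ← lintegral_indicator (hΩ.compl.prod hΩ), ← lintegral_indicator (hΩ.prod hΩ.compl),
      ← lintegral_swap_compProd hrev (f := (Ωᶜ ×ˢ Ω).indicator fun p => f p.1)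
        ((hf.comp measurable_fst).indicator (hΩ.compl.prod hΩ))]
    refine lintegral_congr fun p => ?_
    simp only [Set.indicator, Set.mem_prod, Prod.fst_swap, Prod.snd_swap]
    grind
  have hp : Measurable fun x => max (w x) 0 := hw.max measurable_const
  have hn : Measurable fun x => max (-w x) 0 := hw.neg.max measurable_const
  have A := mul_setLIntegral_le hΩ hl h hp fun x => le_max_right _ _
  have B := setLIntegral_le_mul hΩ hfin hl hlΩ h hn fun x => le_max_right _ _
  simp only [ENNReal.ofReal_max, ENNReal.ofReal_zero,
    max_eq_left (zero_le (a := ENNReal.ofReal _))] at A B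
  rw [swap (fun x => ENNReal.ofReal (-w x)) hw.neg.ennreal_ofReal,
    swap (fun x => ENNReal.ofReal (w x)) hw.ennreal_ofReal, totalVariation_eq hrev hw]
  have hw1 : Measurable fun p : X × X => w p.1 := hw.comp measurable_fst
  have hw2 : Measurable fun p : X × X => w p.2 := hw.comp measurable_snd
  -- Pointwise this is `a - b ≤ (a - b)⁺`, rearranged so that no subtraction occurs in `[0, ∞]`.
  have C : ∫⁻ p in Ω ×ˢ Ωᶜ, ENNReal.ofReal (w p.1) ∂(ν ⊗ₘ m)
        + ∫⁻ p in Ω ×ˢ Ωᶜ, ENNReal.ofReal (-w p.2) ∂(ν ⊗ₘ m)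
      ≤ ∫⁻ p in Ω ×ˢ Ωᶜ, ENNReal.ofReal (-w p.1) ∂(ν ⊗ₘ m)
        + ∫⁻ p in Ω ×ˢ Ωᶜ, ENNReal.ofReal (w p.2) ∂(ν ⊗ₘ m)
        + ∫⁻ p in Ω ×ˢ Ωᶜ, ENNReal.ofReal (w p.1 - w p.2) ∂(ν ⊗ₘ m) := by
    rw [← lintegral_add_left hw1.ennreal_ofReal, ← lintegral_add_left (by fun_prop),
      ← lintegral_add_left (by fun_prop)]
    refine lintegral_mono fun p => ?_
    simp only [ENNReal.ofReal, ← ENNReal.coe_add, ENNReal.coe_le_coe, ← NNReal.coe_le_coe,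
      NNReal.coe_add, Real.coe_toNNReal']
    grind
  -- An increment of `w` is the sum of the increments of `w⁺` and `-w⁻`, which have the same sign.
  have D : ∫⁻ p in Ω ×ˢ Ω, ENNReal.ofReal (max (w p.1) 0 - max (w p.2) 0) ∂(ν ⊗ₘ m)
        + ∫⁻ p in Ω ×ˢ Ω, ENNReal.ofReal (max (-w p.2) 0 - max (-w p.1) 0) ∂(ν ⊗ₘ m)
      ≤ ∫⁻ p in Ω ×ˢ Ω, ENNReal.ofReal (w p.1 - w p.2) ∂(ν ⊗ₘ m) := by
    rw [← lintegral_add_left (by fun_prop)]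
    refine lintegral_mono fun p => ?_
    simp only [ENNReal.ofReal, ← ENNReal.coe_add, ENNReal.coe_le_coe, ← NNReal.coe_le_coe,
      NNReal.coe_add, Real.coe_toNNReal']
    grind
  -- Pairs starting outside `Ω` are discarded.
  have G : ∫⁻ p in Ω ×ˢ Ω, ENNReal.ofReal (w p.1 - w p.2) ∂(ν ⊗ₘ m)
        + ∫⁻ p in Ω ×ˢ Ωᶜ, ENNReal.ofReal (w p.1 - w p.2) ∂(ν ⊗ₘ m)
      ≤ ∫⁻ p, ENNReal.ofReal (w p.1 - w p.2) ∂(ν ⊗ₘ m) := by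
    rw [← lintegral_union (hΩ.prod hΩ.compl)
      (Set.disjoint_prod.2 (.inr disjoint_compl_right))]
    exact setLIntegral_le_lintegral _ _
  have combine : ∀ {a b c d d' r s t x y z : ℝ≥0∞}, a ≤ d + c → x ≤ d' + b →
      c + y ≤ x + z + r → d + d' ≤ s → s + r ≤ t → a + y ≤ (b + z) + t := by
    intro a b c d d' r s t x y z hA hB hC hD hG
    calc a + y ≤ d + c + y := by gcongr
      _ = d + (c + y) := add_assoc _ _ _
      _ ≤ d + (x + z + r) := by gcongr
      _ ≤ d + (d' + b + z + r) := by gcongr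
      _ = b + z + (d + d' + r) := by ring
      _ ≤ b + z + (s + r) := by gcongr
      _ ≤ b + z + t := by gcongr
  exact combine A B C D G

end Symmetric

/-! ### Pairings in `L²` and the subdifferential. -/

section Hilbert

variable {X : Type*} [MeasurableSpace X] {m : Kernel X X} {ν : Measure X}

theorem memLp_indicator_one {s : Set X} (hs : NullMeasurableSet s ν) (hfin : ν s ≠ ∞) :
    MemLp (s.indicator fun _ => (1 : ℝ)) 2 ν := by
  obtain ⟨t, -, ht, hts⟩ := hs.exists_measurable_subset_ae_eq
  exact (memLp_indicator_const 2 ht (1 : ℝ) (.inr (measure_congr hts ▸ hfin))).ae_eq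
    (indicator_ae_eq_of_ae_eq_set hts)

theorem inner_toLp {g : X → ℝ} (hg : MemLp g 2 ν) (w : Lp ℝ 2 ν) :
    inner ℝ (hg.toLp g) w = ∫ x, g x * w x ∂ν := by
  rw [L2.inner_def]
  refine integral_congr_ae ?_
  filter_upwards [hg.coeFn_toLp] with x hx
  simp [hx, mul_comm]

theorem inner_toLp_indicator {g : X → ℝ} (hg : MemLp g 2 ν) {s : Set X}
    (hs : NullMeasurableSet s ν) (hfin : ν s ≠ ∞) {c : ℝ} (hc : ∀ x ∈ s, g x = c) :
    inner ℝ (hg.toLp g) ((memLp_indicator_one hs hfin).toLp _) = c * (ν s).toReal := by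
  have e : ∫ x, g x * (memLp_indicator_one hs hfin).toLp _ x ∂ν
      = ∫ x, s.indicator (fun _ => c) x ∂ν := by
    refine integral_congr_ae ?_
    filter_upwards [(memLp_indicator_one hs hfin).coeFn_toLp] with x hx
    rw [hx]
    by_cases h : x ∈ s <;> simp [h, hc]
  rw [inner_toLp, e, integral_indicator₀ hs]
  simp [Measure.real, mul_comm]

theorem energy_toLp [IsMarkovKernel m] (hrev : m.IsReversible ν) {u : X → ℝ} (hu : MemLp u 2 ν) :
    energy m ν (hu.toLp u) = (totalVariation m ν u : EReal) :=
  congrArg _ (totalVariation_congr hrev hu.coeFn_toLp)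

theorem coe_perimeter [IsMarkovKernel m] {s : Set X} (hfin : ν s ≠ ∞) :
    ((perimeter m ν s : ℝ≥0∞) : EReal) = ((perimeter m ν s).toReal : ℝ) := by
  have h := ne_top_of_le_ne_top hfin (perimeter_le m ν s)
  lift perimeter m ν s to NNReal using h with p
  rfl

theorem lam_mul (s : Set X) (h0 : ν s ≠ 0) (hfin : ν s ≠ ∞) :
    lam m ν s * (ν s).toReal = (perimeter m ν s).toReal := by
  rw [lam, ← ENNReal.toReal_mul, ENNReal.div_mul_cancel h0 hfin]

/-- For `g` constant equal to `λ_Ω` on `Ω`, the condition `-g ∈ Δ_1 χ_Ω` says that the linear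
functional `⟨g, ·⟩` is dominated by the energy. -/
theorem memOneLaplacian_neg_indicator_iff [IsMarkovKernel m] [SigmaFinite ν]
    (hrev : m.IsReversible ν) {Ω : Set X}
    (hΩ : NullMeasurableSet Ω ν) (h0 : ν Ω ≠ 0) (hfin : ν Ω ≠ ∞) {g : X → ℝ}
    (hg : ∀ x ∈ Ω, g x = lam m ν Ω) :
    MemOneLaplacian m ν (fun x => -g x) (Ω.indicator fun _ => 1) ↔
      ∃ hgL : MemLp g 2 ν, ∀ w : Lp ℝ 2 ν,
        ((inner ℝ (hgL.toLp g) w : ℝ) : EReal) ≤ energy m ν w := by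
  -- The energy of `χ_Ω` is finite and equals `⟨g, χ_Ω⟩`, so the two cancel.
  have key : ∀ hgL : MemLp g 2 ν, ∀ w : Lp ℝ 2 ν,
      energy m ν ((memLp_indicator_one hΩ hfin).toLp _)
        + ((inner ℝ (hgL.toLp g) (w - (memLp_indicator_one hΩ hfin).toLp _) : ℝ) : EReal)
        = ((inner ℝ (hgL.toLp g) w : ℝ) : EReal) := by
    intro hgL w
    rw [energy_toLp hrev, totalVariation_indicator hrev hΩ, coe_perimeter hfin, inner_sub_right,
      inner_toLp_indicator hgL hΩ hfin hg, lam_mul Ω h0 hfin, ← EReal.coe_add, add_sub_cancel]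
  constructor
  · rintro ⟨hv, hu, h⟩
    have hgL : MemLp g 2 ν := (funext fun x => neg_neg (g x) : (-fun x => -g x) = g) ▸ hv.neg
    have e : -hv.toLp _ = hgL.toLp g := by
      rw [← MemLp.toLp_neg]
      congr 1
      ext x
      simp
    refine ⟨hgL, fun w => ?_⟩
    rw [← key hgL w, ← e]
    exact h w
  · rintro ⟨hgL, h⟩
    refine ⟨hgL.neg, memLp_indicator_one hΩ hfin, fun w => ?_⟩
    have e : -hgL.neg.toLp _ = hgL.toLp g := by
      rw [← MemLp.toLp_neg]
      congr 1
      exact neg_neg g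
    have hk := h w
    rw [← key hgL w, ← e] at hk
    exact hk

/-- Clearing denominators admits null sets `E`, so the inequality applies to every superlevel set.
-/
theorem isCalibrable_iff {Ω : Set X} (hΩ : NullMeasurableSet Ω ν) (h0 : ν Ω ≠ 0)
    (hfin : ν Ω ≠ ∞) :
    IsCalibrable m ν Ω ↔ ∀ E ⊆ Ω, NullMeasurableSet E ν →
      perimeter m ν Ω / ν Ω * ν E ≤ perimeter m ν E := by
  unfold IsCalibrable cheegerConstant
  constructor
  · intro h E hE hEm
    rcases eq_or_ne (ν E) 0 with hE0 | hE0
    · simp [hE0]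
    · rw [← ENNReal.le_div_iff_mul_le (.inl hE0)
        (.inl (ne_top_of_le_ne_top hfin (measure_mono hE))), ← h]
      exact sInf_le ⟨E, hE, hEm, pos_iff_ne_zero.2 hE0, rfl⟩
  · intro h
    refine le_antisymm (sInf_le ⟨Ω, subset_rfl, hΩ, pos_iff_ne_zero.2 h0, rfl⟩) (le_sInf ?_)
    rintro _ ⟨E, hE, hEm, hE0, rfl⟩
    rw [ENNReal.le_div_iff_mul_le (.inl hE0.ne')
      (.inl (ne_top_of_le_ne_top hfin (measure_mono hE)))]
    exact h E hE hEm

/-- The test functions `χ_E` with `E ⊆ Ω` see only the values of `g` on `Ω`. -/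
theorem isCalibrable_of_inner_le [IsMarkovKernel m] [SigmaFinite ν] (hrev : m.IsReversible ν)
    {Ω : Set X}
    (hΩ : NullMeasurableSet Ω ν) (h0 : ν Ω ≠ 0) (hfin : ν Ω ≠ ∞) {g : X → ℝ}
    (hg : ∀ x ∈ Ω, g x = lam m ν Ω) (hgL : MemLp g 2 ν)
    (h : ∀ w : Lp ℝ 2 ν, ((inner ℝ (hgL.toLp g) w : ℝ) : EReal) ≤ energy m ν w) :
    IsCalibrable m ν Ω := by
  rw [isCalibrable_iff hΩ h0 hfin]
  intro E hE hEm
  have hEfin : ν E ≠ ∞ := ne_top_of_le_ne_top hfin (measure_mono hE)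
  have hk := h ((memLp_indicator_one hEm hEfin).toLp _)
  rw [energy_toLp hrev, totalVariation_indicator hrev hEm, coe_perimeter hEfin,
    inner_toLp_indicator hgL hEm hEfin fun x hx => hg x (hE hx), EReal.coe_le_coe_iff, lam,
    ← ENNReal.toReal_mul] at hk
  refine (ENNReal.toReal_le_toReal (ENNReal.mul_ne_top (ENNReal.div_ne_top ?_ h0) hEfin) ?_).1 hk
  · exact ne_top_of_le_ne_top hfin (perimeter_le m ν Ω)
  · exact ne_top_of_le_ne_top hEfin (perimeter_le m ν E)

/-! ### The function `λτ*` and its domination by the energy. -/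

open Classical in
/-- The function `λ_Ω τ*`, which is `λ_Ω` on `Ω` and `-m_x(Ω)` off `Ω`. -/
theorem lam_mul_tauStar {Ω : Set X} (hl : lam m ν Ω ≠ 0) (x : X) :
    lam m ν Ω * tauStar m ν Ω x = if x ∈ Ω then lam m ν Ω else -(m x Ω).toReal := by
  unfold tauStar
  split_ifs
  · rw [mul_one]
  · field_simp

open Classical in
theorem measurable_ite_measure {Ω : Set X} (hΩ : MeasurableSet Ω) (c : ℝ) :
    Measurable fun x => if x ∈ Ω then c else -(m x Ω).toReal :=
  Measurable.ite hΩ measurable_const (m.measurable_coe hΩ).ennreal_toReal.neg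

open Classical in
theorem ite_measure_ae_eq [IsMarkovKernel m] (hrev : m.IsReversible ν) {Ω s : Set X}
    (h : s =ᵐ[ν] Ω) (c : ℝ) :
    (fun x => if x ∈ s then c else -(m x s).toReal)
      =ᵐ[ν] fun x => if x ∈ Ω then c else -(m x Ω).toReal := by
  filter_upwards [h.mem_iff, ae_measure_congr hrev h] with x hx hx'
  simp [hx, hx']

-- Reversibility gives `∫ m_x(Ω) dν = ν(Ω) < ∞`, and `m_x(Ω)² ≤ m_x(Ω)` since `m_x(Ω) ≤ 1`.
open Classical in
theorem memLp_ite_measure [IsMarkovKernel m] (hrev : m.IsReversible ν) {Ω : Set X}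
    (hΩ : MeasurableSet Ω)
    (hfin : ν Ω ≠ ∞) (c : ℝ) :
    MemLp (fun x => if x ∈ Ω then c else -(m x Ω).toReal) 2 ν := by
  have hmeas := measurable_ite_measure (m := m) hΩ c
  have h1 : Integrable (fun x => (m x Ω).toReal) ν := by
    refine integrable_toReal_of_lintegral_ne_top (m.measurable_coe hΩ).aemeasurable ?_
    have := hrev MeasurableSet.univ hΩ
    simp only [Measure.restrict_univ, measure_univ, lintegral_one, Measure.restrict_apply_univ]
      at this
    rwa [this]
  have h2 : Integrable (Ω.indicator fun _ => c ^ 2) ν :=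
    (integrable_indicator_iff hΩ).2 (integrableOn_const hfin)
  rw [memLp_two_iff_integrable_sq hmeas.aestronglyMeasurable]
  refine (h2.add h1).mono' (hmeas.pow_const 2).aestronglyMeasurable (.of_forall fun x => ?_)
  have h3 : (m x Ω).toReal ≤ 1 := ENNReal.toReal_le_of_le_ofReal zero_le_one (by simp [prob_le_one])
  have h4 : 0 ≤ (m x Ω).toReal := ENNReal.toReal_nonneg
  by_cases hx : x ∈ Ω
  · simp [hx]
  · simp [hx]
    nlinarith

open Classical in
theorem inner_le_energy [IsMarkovKernel m] [SigmaFinite ν] (hrev : m.IsReversible ν) {Ω : Set X}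
    (hΩ : MeasurableSet Ω) (h0 : ν Ω ≠ 0) (hfin : ν Ω ≠ ∞)
    (h : ∀ E ⊆ Ω, MeasurableSet E → perimeter m ν Ω / ν Ω * ν E ≤ perimeter m ν E)
    (hg : MemLp (fun x => if x ∈ Ω then lam m ν Ω else -(m x Ω).toReal) 2 ν) (w : Lp ℝ 2 ν) :
    ((inner ℝ (hg.toLp _) w : ℝ) : EReal) ≤ energy m ν w := by
  have hw : Measurable w := (Lp.stronglyMeasurable w).measurable
  have hl : perimeter m ν Ω / ν Ω ≠ ∞ :=
    ENNReal.div_ne_top (ne_top_of_le_ne_top hfin (perimeter_le m ν Ω)) h0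
  rw [inner_toLp]
  refine integral_le_of_lintegral_le (hg.integrable_mul (Lp.memLp w)) ?_
  -- Used for `w` and for `-w`, this computes the positive and negative parts of the pairing.
  have key : ∀ f : X → ℝ, Measurable f →
      ∫⁻ x, ENNReal.ofReal ((if x ∈ Ω then lam m ν Ω else -(m x Ω).toReal) * f x) ∂ν
        = perimeter m ν Ω / ν Ω * ∫⁻ x in Ω, ENNReal.ofReal (f x) ∂ν
          + ∫⁻ x in Ωᶜ, ENNReal.ofReal (-f x) * m x Ω ∂ν := by
    intro f hf
    rw [← lintegral_add_compl _ hΩ, ← lintegral_const_mul' _ _ hl]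
    congr 1
    · refine setLIntegral_congr_fun hΩ fun x hx => ?_
      simp only [if_pos hx]
      rw [lam, ENNReal.ofReal_mul ENNReal.toReal_nonneg, ENNReal.ofReal_toReal hl]
    · refine setLIntegral_congr_fun hΩ.compl fun x hx => ?_
      simp only [if_neg hx]
      rw [neg_mul_comm, mul_comm, ENNReal.ofReal_mul' ENNReal.toReal_nonneg,
        ENNReal.ofReal_toReal (measure_ne_top _ _)]
  have kn := key (fun x => -w x) hw.neg
  simp only [mul_neg, neg_neg] at kn
  simp only [Pi.mul_apply]
  rw [key _ hw, kn]
  refine lintegral_pairing_le hrev hΩ hfin hl ?_ ?_ hw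
  · rw [ENNReal.div_mul_cancel h0 hfin, perimeter_eq_compProd m ν hΩ]
  · exact fun E hE hEm => (h E hE hEm).trans_eq (perimeter_eq_compProd m ν hEm)

theorem memOneLaplacian_tauStar_of_isCalibrable [IsMarkovKernel m] [SigmaFinite ν]
    (hrev : m.IsReversible ν)
    {Ω : Set X} (hΩ : NullMeasurableSet Ω ν) (h0 : ν Ω ≠ 0) (hfin : ν Ω ≠ ∞)
    (hl : lam m ν Ω ≠ 0) (h : IsCalibrable m ν Ω) :
    MemOneLaplacian m ν (fun x => -(lam m ν Ω * tauStar m ν Ω x)) (Ω.indicator fun _ => 1) := by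
  classical
  -- A measurable representative inside `Ω` is chosen, so that competitors `E ⊆ s` are also
  -- competitors for `Ω`.
  obtain ⟨s, hsΩ, hs, hae⟩ := hΩ.exists_measurable_subset_ae_eq
  have hν : ν s = ν Ω := measure_congr hae
  have hP : perimeter m ν s = perimeter m ν Ω := perimeter_congr hrev hae
  have hlam : lam m ν s = lam m ν Ω := by rw [lam, lam, hν, hP]
  have hcal := (isCalibrable_iff hΩ h0 hfin).1 h
  rw [← hν] at h0 hfin
  have hL := memLp_ite_measure hrev hs hfin (lam m ν s)
  have hae' := ite_measure_ae_eq hrev hae (lam m ν Ω)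
  simp_rw [lam_mul_tauStar hl]
  rw [hν] at h0 hfin
  refine (memOneLaplacian_neg_indicator_iff hrev hΩ h0 hfin fun x hx => if_pos hx).2 ?_
  rw [← hlam] at hae' ⊢
  refine ⟨hL.ae_eq hae', fun w => ?_⟩
  rw [← (MemLp.toLp_eq_toLp_iff hL (hL.ae_eq hae')).2 hae']
  refine inner_le_energy hrev hs (hν ▸ h0) (hν ▸ hfin) (fun E hE hEm => ?_) hL w
  rw [hν, hP]
  exact hcal E (hE.trans hsΩ) hEm.nullMeasurableSet

/-- Since `ν Ω < ν Set.univ`, the complement is not null, and connectedness makes `P(Ω)` positive.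
This legitimates the division by `λ` in `tauStar`. -/
theorem lam_pos [IsMarkovKernel m] (hconn : IsConnected m ν) {Ω : Set X}
    (hΩ : NullMeasurableSet Ω ν)
    (h0 : ν Ω ≠ 0) (hlt : ν Ω < ν Set.univ) : 0 < lam m ν Ω := by
  have hfin : ν Ω ≠ ∞ := hlt.ne_top
  have hc : ν Ωᶜ ≠ 0 := by
    intro hc
    have := measure_union_le (μ := ν) Ω Ωᶜ
    rw [Set.union_compl_self, hc, add_zero] at this
    exact absurd hlt this.not_gt
  have hp := hconn Ω Ωᶜ hΩ hΩ.compl h0 hc (Set.union_compl_self Ω)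
  exact ENNReal.toReal_pos (ENNReal.div_ne_zero.2 ⟨hp.ne', hfin⟩)
    (ENNReal.div_ne_top (ne_top_of_le_ne_top hfin (perimeter_le m ν Ω)) h0)

end Hilbert

end MRW

theorem theorem5p3 {X : Type*} [MetricSpace X] [PolishSpace X] [MeasurableSpace X] [BorelSpace X]
    (m : Kernel X X) (hm : MRW.IsRandomWalk m)
    (ν : Measure X) [SigmaFinite ν] (hrev : m.IsReversible ν) (hconn : MRW.IsConnected m ν)
    (Ω : Set X) (hΩ : NullMeasurableSet Ω ν) (hpos : 0 < ν Ω) (hlt : ν Ω < ν Set.univ) :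
    List.TFAE
      [MRW.IsCalibrable m ν Ω,
       ∃ τ : X → ℝ, AEMeasurable τ ν ∧ (∀ x ∈ Ω, τ x = 1) ∧
         MRW.MemOneLaplacian m ν (fun x => -(MRW.lam m ν Ω * τ x)) (Ω.indicator (fun _ => 1)),
       MRW.MemOneLaplacian m ν (fun x => -(MRW.lam m ν Ω * MRW.tauStar m ν Ω x))
         (Ω.indicator (fun _ => 1))] := by
  have := hm.isMarkov
  have hl := (MRW.lam_pos hconn hΩ hpos.ne' hlt).ne'
  have hfin : ν Ω ≠ ∞ := hlt.ne_top
  tfae_have 1 → 3 :=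
    MRW.memOneLaplacian_tauStar_of_isCalibrable hrev hΩ hpos.ne' hfin hl
  tfae_have 3 → 2 := by
    intro h
    refine ⟨MRW.tauStar m ν Ω, ?_, fun x hx => if_pos hx, h⟩
    obtain ⟨hv, -, -⟩ := h
    -- Measurability of `τ*` is read off from that of `-λτ*`, dividing by `-λ ≠ 0`.
    have := hv.aestronglyMeasurable.aemeasurable.const_mul (-(MRW.lam m ν Ω)⁻¹)
    refine this.congr (.of_forall fun x => ?_)
    field_simp
  tfae_have 2 → 1 := by
    rintro ⟨τ, -, hτ, h⟩
    have hg : ∀ x ∈ Ω, MRW.lam m ν Ω * τ x = MRW.lam m ν Ω := fun x hx => by rw [hτ x hx, mul_one]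
    obtain ⟨hgL, h⟩ := (MRW.memOneLaplacian_neg_indicator_iff hrev hΩ hpos.ne' hfin hg).1 h
    exact MRW.isCalibrable_of_inner_le hrev hΩ hpos.ne' hfin hg hgL h
  tfae_finish
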